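/- Let $T\ge 1$ and consider two large traders $i\in\{1,2\}$ with risk aversions $\gamma^i>0$ who trade one asset at the dates $t=1,\dots,T$. The parameters are $\lambda_t>0$, $\alpha_t,\beta_t\in[0,1]$ and $\rho\ge 0$ with $\alpha_t e^{-\rho}+\beta_t<1$; $a_t,b_t\in\mathbb R$, $\sigma^{\mathcal I}_t\ge 0$, $\sigma^{\epsilon}_t>0$ and $\varrho\in(-1,1)$. The pairs $(\omega_t,\epsilon_t)$, $t=1,\dots,T$, are independent and centred bivariate normal with $\mathrm{Var}\,\omega_t=1$, $\mathrm{Var}\,\epsilon_t=(\sigma^\epsilon_t)^2$ and correlation $\varrho$. The Markovian environment is $\mathcal I_0=0$, $\mathcal I_t=a_t-b_t\mathcal I_{t-1}+\sigma^{\mathcal I}_t\omega_t$ for $1\le t\le T$. The state at date $t$ is $\boldsymbol s_t=(W^1_t,W^2_t,P_t,\overline Q^1_t,\overline Q^2_t,R_t,\mathcal I_{t-1})\in\mathbb R^7$ (wealths, price, remaining volumes, residual effect of past price impacts, previous environment). If the traders execute $q^1_t,q^2_t\in\mathbb R$, then, with $\bar q_t=q^1_t+q^2_t$, $$W^i_{t+1}=W^i_t-(P_t+\lambda_t\bar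 q_t)q^i_t,\qquad \overline Q^i_{t+1}=\overline Q^i_t-q^i_t,\qquad R_{t+1}=e^{-\rho}(R_t+\alpha_t\lambda_t\bar q_t),$$ $$P_{t+1}=P_t-(1-e^{-\rho})R_t+(\alpha_te^{-\rho}+\beta_t)\lambda_t\bar q_t+\mathcal I_t+\epsilon_t .$$ A Markov execution strategy $\pi^i=(f^i_1,\dots,f^i_T)$ consists of Borel maps $f^i_t:\mathbb R^7\to\mathbb R$, with $q^i_t=f^i_t(\boldsymbol s_t)$. Let $V^i_t(\pi^1,\pi^2)[\boldsymbol s]\in[-\infty,0]$ be the expectation, when $\boldsymbol s_t=\boldsymbol s$ and both traders follow $(\pi^1,\pi^2)$ from date $t$ on, of the terminal utility, which is $-\exp(-\gamma^iW^i_{T+1})$ if $\overline Q^i_{T+1}=0$ and $-\infty$ otherwise. A pair $(\pi^1,\pi^2)$ is a Markov perfect equilibrium if for all $t\in\{1,\dots,T\}$ and all $\boldsymbol s\in\mathbb R^7$ neither trader can increase his or her $V^i_t[\boldsymbol s]$ by switching to another Markov execution strategy. Assume in addition that $\alpha_t+\beta_t\ne\frac32$ for $2\le t\le T-2$ (this holds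 in particular if $\alpha_t+\beta_t\le 1$). **Corollary.** Suppose that the Markovian environment is deterministic in time, i.e. there are constants $c_1,\dots,c_T$ with $\mathcal I_t=c_t$ almost surely for $t=1,\dots,T$. Then, at every Markov perfect equilibrium, the execution strategy of each large trader is deterministic as well: for all initial wealths, every initial price, all target volumes $\overline Q^1_1,\overline Q^2_1\in\mathbb R$, with $R_1=\mathcal I_0=0$, and for each $i\in\{1,2\}$ there are constants $k^i_1,\dots,k^i_T\in\mathbb R$ such that the equilibrium execution volumes along the path started there satisfy $q^{i}_t=k^i_t$ almost surely for $t=1,\dots,T$. -/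

import Mathlib

open MeasureTheory ProbabilityTheory

noncomputable section

namespace ExecutionGame

/-- Data of the two-trader execution game with trading dates `1, …, horizon`.
Sequences are indexed by `ℕ`; only their values at the dates `1, …, horizon` are ever used.
The two large traders are indexed by `Fin 2`. -/
structure Market where
  /-- The number `T` of trading dates. -/
  horizon : ℕ
  /-- Instantaneous price impact `λ_t` of one unit. -/
  lam : ℕ → ℝ
  /-- Temporary impact coefficient `α_t`. -/
  alpha : ℕ → ℝ
  /-- Permanent impact coefficient `β_t`. -/
  beta : ℕ → ℝ
  /-- Resilience speed `ρ`. -/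
  rho : ℝ
  /-- Intercept `a_t` of the Markovian environment. -/
  envA : ℕ → ℝ
  /-- Mean-reversion coefficient `b_t` of the Markovian environment. -/
  envB : ℕ → ℝ
  /-- Standard deviation `σ_t` of the innovation of the Markovian environment. -/
  envSigma : ℕ → ℝ
  /-- Standard deviation of the public news `ε_t`. -/
  newsSigma : ℕ → ℝ
  /-- Correlation coefficient of `I_t` and `ε_t` given `I_{t-1}`. -/
  corr : ℝ
  /-- Absolute risk aversion parameters `γ¹, γ²`. -/
  gamma : Fin 2 → ℝ

/-- The standing assumptions on the market parameters. -/
structure Market.Standing (m : Market) : Prop where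
  horizon_pos : 1 ≤ m.horizon
  lam_pos : ∀ t ∈ Finset.Icc 1 m.horizon, 0 < m.lam t
  alpha_mem : ∀ t ∈ Finset.Icc 1 m.horizon, m.alpha t ∈ Set.Icc (0 : ℝ) 1
  beta_mem : ∀ t ∈ Finset.Icc 1 m.horizon, m.beta t ∈ Set.Icc (0 : ℝ) 1
  rho_nonneg : 0 ≤ m.rho
  impact_lt_one : ∀ t ∈ Finset.Icc 1 m.horizon, m.alpha t * Real.exp (-m.rho) + m.beta t < 1
  envSigma_nonneg : ∀ t ∈ Finset.Icc 1 m.horizon, 0 ≤ m.envSigma t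
  newsSigma_pos : ∀ t ∈ Finset.Icc 1 m.horizon, 0 < m.newsSigma t
  corr_mem : m.corr ∈ Set.Ioo (-1 : ℝ) 1
  gamma_pos : ∀ i, 0 < m.gamma i

/-- The law of `(ω_t, ε_t)`: the centred bivariate normal law with `Var ω_t = 1`,
`Var ε_t = newsSigma t ^ 2` and correlation `corr`, written as the image of a pair of
independent standard normal variables. -/
def Market.noiseLaw (m : Market) (t : ℕ) : Measure (ℝ × ℝ) :=
  ((gaussianReal 0 1).prod (gaussianReal 0 1)).map
    (fun z => (z.1, m.newsSigma t * (m.corr * z.1 + Real.sqrt (1 - m.corr ^ 2) * z.2)))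

/-- `ξ t = (ω_t, ε_t)`, `t = 1, …, T`, is a family of independent random pairs on `(Ω, μ)`
with the prescribed laws. -/
structure Market.IsNoise (m : Market) {Ω : Type*} [MeasurableSpace Ω] (μ : Measure Ω)
    (ξ : ℕ → Ω → ℝ × ℝ) : Prop where
  measurable : ∀ t ∈ Finset.Icc 1 m.horizon, Measurable (ξ t)
  indep : iIndepFun (fun t : Finset.Icc 1 m.horizon => ξ t) μ
  law : ∀ t ∈ Finset.Icc 1 m.horizon, μ.map (ξ t) = m.noiseLaw t

/-- The Markovian environment: `I_0 = 0` and `I_{t+1} = a_{t+1} - b_{t+1} I_t + σ_{t+1} ω_{t+1}`. -/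
def Market.env (m : Market) {Ω : Type*} (ξ : ℕ → Ω → ℝ × ℝ) : ℕ → Ω → ℝ
  | 0, _ => 0
  | t + 1, x => m.envA (t + 1) - m.envB (t + 1) * m.env ξ t x + m.envSigma (t + 1) * (ξ (t + 1) x).1

/-- The state `(W, P, Q, R, I)` at a date `t`: wealths `W¹_t, W²_t`, market price `P_t`,
remaining execution volumes `Q¹_t, Q²_t`, residual effect `R_t` of past price impacts, and the
previous environment `I_{t-1}`. As a measurable space this is `ℝ⁷`. -/
abbrev State : Type := (Fin 2 → ℝ) × ℝ × (Fin 2 → ℝ) × ℝ × ℝ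

namespace State

/-- The wealth of each trader. -/
abbrev wealth (s : State) : Fin 2 → ℝ := s.1
/-- The market price. -/
abbrev price (s : State) : ℝ := s.2.1
/-- The remaining execution volume of each trader. -/
abbrev remaining (s : State) : Fin 2 → ℝ := s.2.2.1
/-- The residual effect of past price impacts. -/
abbrev residual (s : State) : ℝ := s.2.2.2.1
/-- The Markovian environment at the previous date. -/
abbrev prevEnv (s : State) : ℝ := s.2.2.2.2

end State

/-- The law of motion `s_{t+1} = h_t(s_t, q¹_t, q²_t, (ω_t, ε_t))`. -/
def Market.step (m : Market) (t : ℕ) (s : State) (q : Fin 2 → ℝ) (z : ℝ × ℝ) : State :=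
  let e := Real.exp (-m.rho)
  let total := q 0 + q 1
  let I := m.envA t - m.envB t * s.prevEnv + m.envSigma t * z.1
  (fun i => s.wealth i - (s.price + m.lam t * total) * q i,
    s.price - (1 - e) * s.residual + (m.alpha t * e + m.beta t) * m.lam t * total + I + z.2,
    fun i => s.remaining i - q i,
    e * (s.residual + m.alpha t * m.lam t * total),
    I)

/-- A Markov execution strategy: a Borel measurable decision rule `f_t` for each date `t`
(only the dates `1, …, T` matter). -/
structure MarkovStrategy where
  /-- The decision rule used at each date. -/
  rule : ℕ → State → ℝ
  measurable_rule : ∀ t, Measurable (rule t)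

/-- `m.stateFrom ξ π t s n x` is the state at date `t + n` in the scenario `x`, when the state at
date `t` is `s` and both traders follow the profile `π`. -/
def Market.stateFrom (m : Market) {Ω : Type*} (ξ : ℕ → Ω → ℝ × ℝ) (π : Fin 2 → MarkovStrategy)
    (t : ℕ) (s : State) : ℕ → Ω → State
  | 0, _ => s
  | n + 1, x =>
    m.step (t + n) (m.stateFrom ξ π t s n x)
      (fun i => (π i).rule (t + n) (m.stateFrom ξ π t s n x)) (ξ (t + n) x)

/-- The terminal disutility of trader `i`, the negative of the terminal utility payoff:
`exp (-γⁱ Wⁱ)` if nothing remains to be executed, and `∞` otherwise. -/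
def Market.terminalLoss (m : Market) (i : Fin 2) (s : State) : ENNReal :=
  if s.remaining i = 0 then ENNReal.ofReal (Real.exp (-m.gamma i * s.wealth i)) else ⊤

/-- The expected utility `Vⁱ_t(π¹, π²)[s]`, with values in `[-∞, 0]`, of trader `i` from date `t`
and state `s` on. As the noise is independent over time and only the noise at dates `t, …, T` enters,
conditioning on `s_t = s` is the same as starting the dynamics at `s`. -/
def Market.value (m : Market) {Ω : Type*} [MeasurableSpace Ω] (μ : Measure Ω)
    (ξ : ℕ → Ω → ℝ × ℝ) (π : Fin 2 → MarkovStrategy) (i : Fin 2) (t : ℕ) (s : State) : EReal :=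
  -((∫⁻ x, m.terminalLoss i (m.stateFrom ξ π t s (m.horizon + 1 - t) x) ∂μ : ENNReal) : EReal)

/-- Markov perfect equilibrium: from every date and every state on, no trader gains by
replacing his or her strategy by another Markov execution strategy. -/
def Market.IsMarkovPerfect (m : Market) {Ω : Type*} [MeasurableSpace Ω] (μ : Measure Ω)
    (ξ : ℕ → Ω → ℝ × ℝ) (π : Fin 2 → MarkovStrategy) : Prop :=
  ∀ t ∈ Finset.Icc 1 m.horizon, ∀ s : State, ∀ i : Fin 2, ∀ dev : MarkovStrategy,
    m.value μ ξ (Function.update π i dev) i t s ≤ m.value μ ξ π i t s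

/-- The initial state: wealths `w`, price `p`, target volumes `Q`, no residual effect, `I_0 = 0`. -/
def initialState (w : Fin 2 → ℝ) (p : ℝ) (Q : Fin 2 → ℝ) : State := (w, p, Q, 0, 0)

/-- The (random) execution volume `qⁱ_t`, `t ≥ 1`, of trader `i` under the profile `π`, along the
path that starts in `s₁` at date `1`. -/
def Market.volume (m : Market) {Ω : Type*} (ξ : ℕ → Ω → ℝ × ℝ) (π : Fin 2 → MarkovStrategy)
    (s₁ : State) (i : Fin 2) (t : ℕ) (x : Ω) : ℝ :=
  (π i).rule t (m.stateFrom ξ π 1 s₁ (t - 1) x)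

/-- A real-valued process is deterministic on the dates `1, …, T`: it agrees almost surely with
a function of time alone. -/
def IsDeterministic {Ω : Type*} [MeasurableSpace Ω] (μ : Measure Ω) (T : ℕ) (Y : ℕ → Ω → ℝ) : Prop :=
  ∃ c : ℕ → ℝ, ∀ t ∈ Finset.Icc 1 T, ∀ᵐ x ∂μ, Y t x = c t

end ExecutionGame

end

/-! ### Exponential moments of the news, and vanishing innovations. -/

namespace ExecutionGame

variable {Ω : Type*} [MeasurableSpace Ω] {μ : Measure Ω} {m : Market} {ξ : ℕ → Ω → ℝ × ℝ}

/-! A deterministic environment has no innovations: a nonzero `envSigma t` would force the standard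
normal ω_t to be constant. The triple (Q, R, I) then evolves without noise once the volumes are
given, and the news enters only through the price. It remains to see that equilibrium volumes depend
on this triple alone; date 1 needs nothing, its state being fixed.

By backward induction from T to 2, terminal wealth is W - PQ plus a quadratic function of the
triple, minus the news weighted by affine exposures (`HasTerminal`). The Gaussian exponential moment
turns expected utility into a quadratic certainty equivalent, so the first-order conditions are
affine in triple and volumes. If they determine the volumes, these are affine in the triple and the
form is inherited (`hasTerminal_step`).

The crux is this uniqueness. At T - 1 the system is definite (`marginal_injective_of_last`).
Earlier, no sign of the continuation is known, but the equilibrium itself supplies a solution for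
every triple. Since the linear part is onto jointly in triple and volumes
(`marginal_sub_surjective`, where the value 3/2 is excluded), it is onto in the volumes alone, hence
injective by finite dimension. -/

theorem lintegral_exp_mul_gaussianReal (v : NNReal) (θ : ℝ) :
    ∫⁻ z, ENNReal.ofReal (Real.exp (θ * z)) ∂(gaussianReal 0 v) =
      ENNReal.ofReal (Real.exp (v * θ ^ 2 / 2)) := by
  rw [← ofReal_integral_eq_lintegral_ofReal (integrable_exp_mul_gaussianReal θ)
    (Filter.Eventually.of_forall fun _ => (Real.exp_pos _).le)]
  have h := congrFun (mgf_id_gaussianReal (μ := 0) (v := v)) θ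
  simp only [mgf, id, zero_mul, zero_add] at h
  rw [h]

theorem Market.measurable_noise_map (m : Market) (t : ℕ) : Measurable (fun z : ℝ × ℝ =>
    (z.1, m.newsSigma t * (m.corr * z.1 + Real.sqrt (1 - m.corr ^ 2) * z.2))) := by
  fun_prop

/-- The moment generating function of the public news. -/
theorem Market.IsNoise.lintegral_exp_news (hξ : m.IsNoise μ ξ) (hcorr : m.corr ∈ Set.Ioo (-1 : ℝ) 1)
    {t : ℕ} (ht : t ∈ Finset.Icc 1 m.horizon) (θ : ℝ) :
    ∫⁻ x, ENNReal.ofReal (Real.exp (θ * (ξ t x).2)) ∂μ =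
      ENNReal.ofReal (Real.exp (m.newsSigma t ^ 2 * θ ^ 2 / 2)) := by
  have hmeas : Measurable fun z : ℝ × ℝ => ENNReal.ofReal (Real.exp (θ * z.2)) := by fun_prop
  rw [← lintegral_map hmeas (hξ.measurable t ht), hξ.law t ht, Market.noiseLaw,
    lintegral_map hmeas (m.measurable_noise_map t)]
  have hsplit : ∀ z : ℝ × ℝ, ENNReal.ofReal (Real.exp (θ * (m.newsSigma t *
      (m.corr * z.1 + Real.sqrt (1 - m.corr ^ 2) * z.2)))) =
      ENNReal.ofReal (Real.exp (θ * m.newsSigma t * m.corr * z.1)) *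
      ENNReal.ofReal (Real.exp (θ * m.newsSigma t * Real.sqrt (1 - m.corr ^ 2) * z.2)) := by
    intro z
    rw [← ENNReal.ofReal_mul (Real.exp_pos _).le, ← Real.exp_add]
    congr 2
    ring
  simp only [hsplit]
  rw [lintegral_prod_mul (f := fun z => ENNReal.ofReal (Real.exp (θ * m.newsSigma t * m.corr * z)))
    (g := fun z => ENNReal.ofReal
      (Real.exp (θ * m.newsSigma t * Real.sqrt (1 - m.corr ^ 2) * z)))
    (by fun_prop) (by fun_prop), lintegral_exp_mul_gaussianReal, lintegral_exp_mul_gaussianReal,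
    ← ENNReal.ofReal_mul (Real.exp_pos _).le, ← Real.exp_add]
  congr 2
  have hs : Real.sqrt (1 - m.corr ^ 2) ^ 2 = 1 - m.corr ^ 2 :=
    Real.sq_sqrt (by nlinarith [hcorr.1, hcorr.2])
  rw [mul_pow _ (Real.sqrt _), hs, NNReal.coe_one]
  ring

/-- The expected exponential disutility of a wealth that is affine in the public news. -/
theorem Market.IsNoise.lintegral_exp_sub_sum (hξ : m.IsNoise μ ξ)
    (hcorr : m.corr ∈ Set.Ioo (-1 : ℝ) 1) {S : Finset ℕ} (hS : S ⊆ Finset.Icc 1 m.horizon)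
    (γ c : ℝ) (y : ℕ → ℝ) :
    ∫⁻ x, ENNReal.ofReal (Real.exp (-γ * (c - ∑ k ∈ S, (ξ k x).2 * y k))) ∂μ =
      ENNReal.ofReal
        (Real.exp (-γ * (c - ∑ k ∈ S, γ / 2 * m.newsSigma k ^ 2 * y k ^ 2))) := by
  -- The exponential of the sum is a product of independent factors, one per date.
  let X : Finset.Icc 1 m.horizon → Ω → ENNReal := fun k x =>
    ENNReal.ofReal (Real.exp (γ * y k * (ξ k x).2))
  have hX : ∀ k, Measurable (X k) := fun k => by
    have := hξ.measurable k k.2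
    fun_prop
  have hind : iIndepFun X μ := hξ.indep.comp
    (fun k z => ENNReal.ofReal (Real.exp (γ * y k * z.2))) (fun k => by fun_prop)
  have hprod : ∀ f : ℕ → ENNReal,
      ∏ k ∈ S.subtype (· ∈ Finset.Icc 1 m.horizon), f k = ∏ k ∈ S, f k := fun f =>
    Finset.prod_subtype_of_mem f fun k hk => hS hk
  have hint := lintegral_prod_eq_prod_lintegral_of_indepFun
    (S.subtype (· ∈ Finset.Icc 1 m.horizon)) X hind hX
  have hlhs : ∀ x, ENNReal.ofReal (Real.exp (-γ * (c - ∑ k ∈ S, (ξ k x).2 * y k))) =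
      ENNReal.ofReal (Real.exp (-γ * c)) *
        ∏ k ∈ S.subtype (· ∈ Finset.Icc 1 m.horizon), X k x := by
    intro x
    rw [hprod fun k => ENNReal.ofReal (Real.exp (γ * y k * (ξ k x).2)),
      ← ENNReal.ofReal_prod_of_nonneg fun _ _ => (Real.exp_pos _).le, ← Real.exp_sum,
      ← ENNReal.ofReal_mul (Real.exp_pos _).le, ← Real.exp_add, mul_sub, sub_eq_add_neg,
      Finset.mul_sum, ← Finset.sum_neg_distrib]
    congr 3
    exact Finset.sum_congr rfl fun k _ => by ring
  simp only [hlhs]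
  rw [lintegral_const_mul _ (Finset.measurable_fun_prod _ fun k _ => hX k), hint,
    Finset.prod_congr (g := fun k : Finset.Icc 1 m.horizon => ENNReal.ofReal
      (Real.exp (m.newsSigma k ^ 2 * (γ * y k) ^ 2 / 2))) rfl
      fun k _ => hξ.lintegral_exp_news hcorr k.2 (γ * y k),
    hprod fun k => ENNReal.ofReal (Real.exp (m.newsSigma k ^ 2 * (γ * y k) ^ 2 / 2)),
    ← ENNReal.ofReal_prod_of_nonneg fun _ _ => (Real.exp_pos _).le, ← Real.exp_sum,
    ← ENNReal.ofReal_mul (Real.exp_pos _).le, ← Real.exp_add, mul_sub, sub_eq_add_neg,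
    Finset.mul_sum, ← Finset.sum_neg_distrib]
  congr 3
  exact Finset.sum_congr rfl fun k _ => by ring

/-- The environment innovations are standard normal, hence not almost surely constant. -/
theorem Market.IsNoise.not_ae_fst_eq (hξ : m.IsNoise μ ξ) {t : ℕ}
    (ht : t ∈ Finset.Icc 1 m.horizon) (c : ℝ) : ¬ ∀ᵐ x ∂μ, (ξ t x).1 = c := by
  intro h
  have hmeas : MeasurableSet {z : ℝ × ℝ | z.1 = c} := measurableSet_eq_fun measurable_fst
    measurable_const
  have h1 : ∀ᵐ z ∂(μ.map (ξ t)), z.1 = c :=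
    (ae_map_iff (hξ.measurable t ht).aemeasurable hmeas).2 h
  rw [hξ.law t ht, Market.noiseLaw,
    ae_map_iff (m.measurable_noise_map t).aemeasurable hmeas] at h1
  have h2 : ∀ᵐ z ∂(gaussianReal 0 1), z = c := by
    have : (gaussianReal 0 1).map id = ((gaussianReal 0 1).prod (gaussianReal 0 1)).map Prod.fst := by
      rw [Measure.map_id, Measure.map_fst_prod]
      simp
    rw [Measure.map_id] at this
    rw [this]
    exact (ae_map_iff (p := fun z => z = c) measurable_fst.aemeasurable
      (measurableSet_singleton c)).2 h1
  have := nullSingletonClass_gaussianReal (μ := 0) (v := 1) one_ne_zero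
  have h3 : ∀ᵐ z ∂(gaussianReal 0 1), z ≠ c := by
    simp [ae_iff]
  obtain ⟨z, hz1, hz2⟩ := (h2.and h3).exists
  exact hz2 hz1

/-- A deterministic environment has no innovations. -/
theorem Market.IsNoise.envSigma_eq_zero (hξ : m.IsNoise μ ξ)
    (henv : IsDeterministic μ m.horizon (m.env ξ)) {t : ℕ} (ht : t ∈ Finset.Icc 1 m.horizon) :
    m.envSigma t = 0 := by
  obtain ⟨c, hc⟩ := henv
  obtain ⟨n, rfl⟩ : ∃ n, t = n + 1 := ⟨t - 1, by have := (Finset.mem_Icc.1 ht).1; omega⟩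
  -- Date 0 lies outside the range of `henv`, but there the environment is 0 by definition.
  have hprev : ∃ d, ∀ᵐ x ∂μ, m.env ξ n x = d := by
    rcases n with _ | n
    · exact ⟨0, Filter.Eventually.of_forall fun _ => rfl⟩
    · exact ⟨c (n + 1), hc _ (by simp only [Finset.mem_Icc] at ht ⊢; omega)⟩
  obtain ⟨d, hd⟩ := hprev
  by_contra hσ
  refine hξ.not_ae_fst_eq ht
    -- The value of ω obtained by solving the recursion for it.
    ((c (n + 1) - m.envA (n + 1) + m.envB (n + 1) * d) / m.envSigma (n + 1)) ?_
  filter_upwards [hd, hc _ ht] with x h1 h2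
  rw [eq_div_iff hσ, ← h2, ← h1, Market.env]
  ring

end ExecutionGame

/-! ### Affine and quadratic maps, and affine equations. -/

namespace ExecutionGame

section Quadratic

variable {E F G : Type*} [AddCommGroup E] [Module ℝ E] [AddCommGroup F] [Module ℝ F]
  [AddCommGroup G] [Module ℝ G]

/-- A map between real vector spaces is affine. -/
def IsAff (f : E → F) : Prop := ∃ (L : E →ₗ[ℝ] F) (c : F), ∀ v, f v = L v + c

/-- A function on a real vector space is a polynomial of degree at most two. -/
def IsQuad (f : E → ℝ) : Prop :=
  ∃ (B : E →ₗ[ℝ] E →ₗ[ℝ] ℝ) (l : E →ₗ[ℝ] ℝ) (c : ℝ), ∀ v, f v = B v v + l v + c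

theorem IsAff.linear (L : E →ₗ[ℝ] F) : IsAff fun v => L v := ⟨L, 0, fun v => by simp⟩

theorem IsAff.const (c : F) : IsAff fun _ : E => c := ⟨0, c, fun v => by simp⟩

theorem IsAff.add {f g : E → F} (hf : IsAff f) (hg : IsAff g) : IsAff fun v => f v + g v := by
  obtain ⟨L, c, hL⟩ := hf
  obtain ⟨M, d, hM⟩ := hg
  exact ⟨L + M, c + d, fun v => by beta_reduce; rw [hL, hM, LinearMap.add_apply]; abel⟩

theorem IsAff.sub {f g : E → F} (hf : IsAff f) (hg : IsAff g) : IsAff fun v => f v - g v := by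
  obtain ⟨L, c, hL⟩ := hf
  obtain ⟨M, d, hM⟩ := hg
  exact ⟨L - M, c - d, fun v => by beta_reduce; rw [hL, hM, LinearMap.sub_apply]; abel⟩

theorem IsAff.const_mul {f : E → ℝ} (a : ℝ) (hf : IsAff f) : IsAff fun v => a * f v := by
  obtain ⟨L, c, hL⟩ := hf
  exact ⟨a • L, a * c, fun v => by beta_reduce; rw [hL, LinearMap.smul_apply, smul_eq_mul]; ring⟩

theorem IsAff.prodMk {f : E → F} {g : E → G} (hf : IsAff f) (hg : IsAff g) :
    IsAff fun v => (f v, g v) := by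
  obtain ⟨L, c, hL⟩ := hf
  obtain ⟨M, d, hM⟩ := hg
  exact ⟨L.prod M, (c, d), fun v => by beta_reduce; rw [hL, hM]; rfl⟩

theorem IsAff.comp {f : F → G} {g : E → F} (hf : IsAff f) (hg : IsAff g) :
    IsAff fun v => f (g v) := by
  obtain ⟨L, c, hL⟩ := hf
  obtain ⟨M, d, hM⟩ := hg
  exact ⟨L ∘ₗ M, L d + c, fun v => by beta_reduce; rw [hM, hL, map_add, add_assoc]; rfl⟩

theorem IsAff.pi {ι : Type*} {f : ι → E → ℝ} (hf : ∀ i, IsAff (f i)) :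
    IsAff fun v i => f i v := by
  choose L c h using hf
  exact ⟨LinearMap.pi L, c, fun v => funext fun i => h i v⟩

theorem IsQuad.const (c : ℝ) : IsQuad fun _ : E => c := ⟨0, 0, c, fun v => by simp⟩

theorem IsQuad.add {f g : E → ℝ} (hf : IsQuad f) (hg : IsQuad g) :
    IsQuad fun v => f v + g v := by
  obtain ⟨B, l, c, h⟩ := hf
  obtain ⟨B', l', c', h'⟩ := hg
  exact ⟨B + B', l + l', c + c', fun v => by beta_reduce; rw [h, h']; simp only [LinearMap.add_apply]; ring⟩

theorem IsQuad.const_mul {f : E → ℝ} (a : ℝ) (hf : IsQuad f) : IsQuad fun v => a * f v := by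
  obtain ⟨B, l, c, h⟩ := hf
  exact ⟨a • B, a • l, a * c, fun v => by
    beta_reduce; rw [h]; simp only [LinearMap.smul_apply, smul_eq_mul]; ring⟩

theorem IsQuad.sub {f g : E → ℝ} (hf : IsQuad f) (hg : IsQuad g) :
    IsQuad fun v => f v - g v := by
  simpa only [neg_one_mul, ← sub_eq_add_neg] using hf.add (hg.const_mul (-1))

theorem IsQuad.sum {ι : Type*} (S : Finset ι) {f : ι → E → ℝ} (hf : ∀ i ∈ S, IsQuad (f i)) :
    IsQuad fun v => ∑ i ∈ S, f i v := by
  classical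
  induction S using Finset.induction_on with
  | empty => simpa using IsQuad.const 0
  | insert a S ha ih =>
    simp only [Finset.sum_insert ha]
    exact (hf a (Finset.mem_insert_self a S)).add
      (ih fun i hi => hf i (Finset.mem_insert_of_mem hi))

theorem IsAff.mul {f g : E → ℝ} (hf : IsAff f) (hg : IsAff g) : IsQuad fun v => f v * g v := by
  obtain ⟨L, c, hL⟩ := hf
  obtain ⟨M, d, hM⟩ := hg
  refine ⟨L.smulRight M, d • L + c • M, c * d, fun v => ?_⟩
  beta_reduce
  rw [hL, hM]
  simp only [LinearMap.smulRight_apply, LinearMap.smul_apply, LinearMap.add_apply, smul_eq_mul]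
  ring

theorem IsQuad.comp {f : F → ℝ} {g : E → F} (hf : IsQuad f) (hg : IsAff g) :
    IsQuad fun v => f (g v) := by
  obtain ⟨B, l, c, h⟩ := hf
  obtain ⟨M, d, hM⟩ := hg
  refine ⟨B.compl₁₂ M M, (B d) ∘ₗ M + (B.flip d) ∘ₗ M + l ∘ₗ M, B d d + l d + c, fun v => ?_⟩
  beta_reduce
  rw [hM, h]
  simp only [map_add, LinearMap.add_apply, LinearMap.compl₁₂_apply, LinearMap.comp_apply,
    LinearMap.flip_apply]
  ring

/-- The central difference of a quadratic polynomial is affine. -/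
theorem IsQuad.isAff_centralDiff {f : E → ℝ} (hf : IsQuad f) (e : E) :
    IsAff fun v => (f (v + e) - f (v - e)) / 2 := by
  obtain ⟨B, l, c, h⟩ := hf
  refine ⟨B e + B.flip e, l e, fun v => ?_⟩
  simp only [h, map_add, map_sub, LinearMap.add_apply, LinearMap.sub_apply, LinearMap.flip_apply]
  ring

/-- First-order condition for a quadratic polynomial. -/
theorem IsQuad.centralDiff_eq_zero {f : E → ℝ} (hf : IsQuad f) {v e : E}
    (hmax : ∀ r : ℝ, f (v + r • e) ≤ f v) : (f (v + e) - f (v - e)) / 2 = 0 := by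
  obtain ⟨B, l, c, h⟩ := hf
  have hle : ∀ r : ℝ, r * (B v e + B e v + l e) + r ^ 2 * B e e ≤ 0 := fun r => by
    have := hmax r
    simp only [h, map_add, map_smul, LinearMap.add_apply, LinearMap.smul_apply, smul_eq_mul] at this
    nlinarith
  have hdiff : (f (v + e) - f (v - e)) / 2 = B v e + B e v + l e := by
    simp only [h, map_add, map_sub, LinearMap.add_apply, LinearMap.sub_apply]
    ring
  rw [hdiff]
  set a := B v e + B e v + l e
  set b := B e e
  have hb : 0 < 1 + |b| := by positivity
  by_contra ha
  -- A step along the slope, short enough that the quadratic term cannot offset the linear gain.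
  have h1 := hle (a / (1 + |b|))
  have h2 : a / (1 + |b|) * a + (a / (1 + |b|)) ^ 2 * b =
      a ^ 2 * (1 + |b| + b) / (1 + |b|) ^ 2 := by
    field_simp
  have h3 : 0 < 1 + |b| + b := by linarith [neg_abs_le b]
  have : 0 < a ^ 2 * (1 + |b| + b) / (1 + |b|) ^ 2 := by positivity
  linarith

/-- If an affine equation in `q` is uniquely solvable at one parameter, its solution is an affine
function of the parameter. -/
theorem IsAff.exists_isAff_solution [FiniteDimensional ℝ F] {A : E × F → F} (hA : IsAff A)
    (hinj : ∀ q, A (0, q) = A (0, 0) → q = 0) :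
    ∃ φ : E → F, IsAff φ ∧ ∀ u q, A (u, q) = 0 → q = φ u := by
  obtain ⟨N, k, hN⟩ := hA
  have hN0 : Function.Injective (N ∘ₗ LinearMap.inr ℝ E F) := by
    rw [← LinearMap.ker_eq_bot, LinearMap.ker_eq_bot']
    intro q hq
    exact hinj q (by rw [hN, hN, ← Prod.zero_eq_mk, map_zero]; simpa using hq)
  let M := LinearEquiv.ofInjectiveEndo _ hN0
  have hM : ∀ q, M q = N (0, q) := fun q => rfl
  refine ⟨fun u => M.symm (-k - N (u, 0)),
    (IsAff.linear M.symm.toLinearMap).comp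
      ((IsAff.const (-k)).sub (IsAff.linear (N ∘ₗ LinearMap.inl ℝ E F))), fun u q h => ?_⟩
  rw [hN] at h
  rw [LinearEquiv.eq_symm_apply, hM, eq_sub_iff_add_eq, ← map_add, eq_neg_iff_add_eq_zero]
  simpa using h

/-- If an affine equation in `q` is solvable for each parameter and its linear part is onto,
then the solution is unique. -/
theorem IsAff.eq_zero_of_solvable [FiniteDimensional ℝ F] {A : E × F → F} (hA : IsAff A)
    (hsolv : ∀ u, ∃ q, A (u, q) = 0) (hsurj : ∀ w, ∃ v, A v - A 0 = w) (q : F)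
    (hq : A (0, q) = A (0, 0)) : q = 0 := by
  obtain ⟨N, k, hN⟩ := hA
  have hsurj0 : Function.Surjective (N ∘ₗ LinearMap.inr ℝ E F) := by
    intro w
    obtain ⟨⟨u, q⟩, hv⟩ := hsurj w
    obtain ⟨q₁, h₁⟩ := hsolv u
    obtain ⟨q₀, h₀⟩ := hsolv 0
    -- Both solutions give `N` the value `-k`, so this correction removes `u` without changing the
    -- image.
    refine ⟨q - q₁ + q₀, ?_⟩
    have hsplit : ((0 : E), q - q₁ + q₀) = (u, q) - (u, q₁) + (0, q₀) := by simp
    rw [LinearMap.comp_apply, LinearMap.inr_apply, hsplit, map_add, map_sub]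
    rw [hN, hN, map_zero] at hv
    rw [hN] at h₁ h₀
    rw [eq_neg_of_add_eq_zero_left h₁, eq_neg_of_add_eq_zero_left h₀, ← hv]
    abel
  have hinj := LinearMap.injective_iff_surjective.2 hsurj0
  apply hinj
  rw [map_zero]
  rw [hN, hN, ← Prod.zero_eq_mk, map_zero] at hq
  simpa using hq

end Quadratic

end ExecutionGame

/-! ### The one-shot game and its first-order conditions. -/

noncomputable section

namespace ExecutionGame

/-- The part `(Q, R, I)` of the state that is not wealth or price. -/
abbrev Reduced : Type := (Fin 2 → ℝ) × ℝ × ℝ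

/-- The law of motion of the reduced state, as a function of the reduced state and the executed
volumes, when the environment has no innovations. -/
def Market.nextReduced (m : Market) (t : ℕ) (v : Reduced × (Fin 2 → ℝ)) : Reduced :=
  (fun i => v.1.1 i - v.2 i,
    Real.exp (-m.rho) * (v.1.2.1 + m.alpha t * m.lam t * (v.2 0 + v.2 1)),
    m.envA t - m.envB t * v.1.2.2)

/-- The expected gain of trader `i` at date `t` in wealth, the remaining volume being marked to
the current price. -/
def Market.gain (m : Market) (t : ℕ) (i : Fin 2) (v : Reduced × (Fin 2 → ℝ)) : ℝ :=
  ((1 - Real.exp (-m.rho)) * v.1.2.1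
    - (m.alpha t * Real.exp (-m.rho) + m.beta t) * m.lam t * (v.2 0 + v.2 1)
    - (m.envA t - m.envB t * v.1.2.2)) * (v.1.1 i - v.2 i)
    - m.lam t * (v.2 0 + v.2 1) * v.2 i

/-- The certainty equivalent at date `t` of the executed volumes, if the terminal wealth
depends on the next reduced state through the mean `h` and the exposures `y` to the news. -/
def Market.certaintyEquiv (m : Market) (t : ℕ) (i : Fin 2) (h : Reduced → ℝ)
    (y : ℕ → Reduced → ℝ) (v : Reduced × (Fin 2 → ℝ)) : ℝ :=
  -- The news of date t moves the price of what is left after trading, so its exposure is the next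
  -- remaining volume. The news of date T comes after the last trade and is omitted.
  m.gain t i v + h (m.nextReduced t v) - ∑ k ∈ Finset.Ico t m.horizon,
    m.gamma i / 2 * m.newsSigma k ^ 2 *
      Function.update y t (fun u => u.1 i) k (m.nextReduced t v) ^ 2

/-- The marginal certainty equivalents of the two traders in their own executed volumes. -/
def Market.marginal (m : Market) (t : ℕ) (h : Fin 2 → Reduced → ℝ)
    (y : Fin 2 → ℕ → Reduced → ℝ) (v : Reduced × (Fin 2 → ℝ)) (i : Fin 2) : ℝ :=
  (m.certaintyEquiv t i (h i) (y i) (v + (0, Pi.single i 1))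
    - m.certaintyEquiv t i (h i) (y i) (v - (0, Pi.single i 1))) / 2

/-- From date `t` on, the profile `π` exhausts the volume of trader `i`, and the terminal wealth
has mean `h` and exposures `y` to the news, up to the current wealth marked to market. -/
structure Market.HasTerminal (m : Market) {Ω : Type*} (ξ : ℕ → Ω → ℝ × ℝ)
    (π : Fin 2 → MarkovStrategy) (t : ℕ) (i : Fin 2) (h : Reduced → ℝ) (y : ℕ → Reduced → ℝ) :
    Prop where
  quad : IsQuad h
  aff : ∀ k ∈ Finset.Ico t m.horizon, IsAff (y k)
  remaining : ∀ s x, (m.stateFrom ξ π t s (m.horizon + 1 - t) x).remaining i = 0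
  wealth : ∀ s x, (m.stateFrom ξ π t s (m.horizon + 1 - t) x).wealth i =
    s.wealth i - s.price * s.remaining i + h s.2.2
      - ∑ k ∈ Finset.Ico t m.horizon, (ξ k x).2 * y k s.2.2

section Algebra

variable {m : Market} {t : ℕ}

theorem isAff_volume (i : Fin 2) : IsAff fun v : Reduced × (Fin 2 → ℝ) => v.2 i :=
  IsAff.linear (LinearMap.proj i ∘ₗ LinearMap.snd ℝ Reduced (Fin 2 → ℝ))

theorem isAff_remaining : ∀ i : Fin 2, IsAff fun u : Reduced => u.1 i := fun i =>
  IsAff.linear (LinearMap.proj i ∘ₗ LinearMap.fst ℝ (Fin 2 → ℝ) (ℝ × ℝ))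

theorem isAff_residual : IsAff fun u : Reduced => u.2.1 :=
  IsAff.linear (LinearMap.fst ℝ ℝ ℝ ∘ₗ LinearMap.snd ℝ (Fin 2 → ℝ) (ℝ × ℝ))

theorem isAff_prevEnv : IsAff fun u : Reduced => u.2.2 :=
  IsAff.linear (LinearMap.snd ℝ ℝ ℝ ∘ₗ LinearMap.snd ℝ (Fin 2 → ℝ) (ℝ × ℝ))

theorem isAff_reduced : IsAff fun v : Reduced × (Fin 2 → ℝ) => v.1 :=
  IsAff.linear (LinearMap.fst ℝ Reduced (Fin 2 → ℝ))

theorem Market.isAff_env (m : Market) (t : ℕ) :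
    IsAff fun v : Reduced × (Fin 2 → ℝ) => m.envA t - m.envB t * v.1.2.2 :=
  (IsAff.const _).sub ((isAff_prevEnv.comp isAff_reduced).const_mul _)

theorem Market.isAff_nextReduced (m : Market) (t : ℕ) : IsAff (m.nextReduced t) :=
  (IsAff.pi fun i => ((isAff_remaining i).comp isAff_reduced).sub (isAff_volume i)).prodMk
    ((((isAff_residual.comp isAff_reduced).add
      (((isAff_volume 0).add (isAff_volume 1)).const_mul _)).const_mul _).prodMk (m.isAff_env t))

theorem Market.isQuad_gain (m : Market) (t : ℕ) (i : Fin 2) : IsQuad (m.gain t i) :=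
  (IsAff.mul ((((isAff_residual.comp isAff_reduced).const_mul _).sub
    (((isAff_volume 0).add (isAff_volume 1)).const_mul _)).sub (m.isAff_env t))
    (((isAff_remaining i).comp isAff_reduced).sub (isAff_volume i))).sub
  (IsAff.mul (((isAff_volume 0).add (isAff_volume 1)).const_mul _) (isAff_volume i))

theorem isAff_update {T : ℕ} {i : Fin 2} {y : ℕ → Reduced → ℝ}
    (hy : ∀ k ∈ Finset.Ico (t + 1) T, IsAff (y k)) {k : ℕ} (hk : k ∈ Finset.Ico t T) :
    IsAff (Function.update y t (fun u => u.1 i) k) := by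
  by_cases hkt : k = t
  · subst hkt
    rw [Function.update_self]
    exact isAff_remaining i
  · rw [Function.update_of_ne hkt]
    exact hy k (by simp only [Finset.mem_Ico] at hk ⊢; omega)

theorem Market.isQuad_certaintyEquiv {i : Fin 2} {h : Reduced → ℝ} {y : ℕ → Reduced → ℝ}
    (hh : IsQuad h) (hy : ∀ k ∈ Finset.Ico (t + 1) m.horizon, IsAff (y k)) :
    IsQuad (m.certaintyEquiv t i h y) := by
  refine ((m.isQuad_gain t i).add (hh.comp (m.isAff_nextReduced t))).sub
    (IsQuad.sum _ fun k hk => IsQuad.const_mul _ ?_)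
  have := (isAff_update (i := i) hy hk).comp (m.isAff_nextReduced t)
  simpa only [sq] using this.mul this

theorem Market.isAff_marginal {h : Fin 2 → Reduced → ℝ} {y : Fin 2 → ℕ → Reduced → ℝ}
    (hh : ∀ i, IsQuad (h i)) (hy : ∀ i, ∀ k ∈ Finset.Ico (t + 1) m.horizon, IsAff (y i k)) :
    IsAff (m.marginal t h y) :=
  IsAff.pi fun i => (m.isQuad_certaintyEquiv (hh i) (hy i)).isAff_centralDiff _

/-- A Nash equilibrium of the one-shot game satisfies the first-order conditions. -/
theorem Market.marginal_eq_zero {h : Fin 2 → Reduced → ℝ} {y : Fin 2 → ℕ → Reduced → ℝ}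
    (hh : ∀ i, IsQuad (h i)) (hy : ∀ i, ∀ k ∈ Finset.Ico (t + 1) m.horizon, IsAff (y i k))
    {u : Reduced} {q : Fin 2 → ℝ}
    (hnash : ∀ i r, m.certaintyEquiv t i (h i) (y i) (u, Function.update q i r) ≤
      m.certaintyEquiv t i (h i) (y i) (u, q)) :
    m.marginal t h y (u, q) = 0 := by
  funext i
  refine (m.isQuad_certaintyEquiv (hh i) (hy i)).centralDiff_eq_zero fun r => ?_
  have : (u, q) + r • ((0 : Reduced), (Pi.single i 1 : Fin 2 → ℝ)) =
      (u, Function.update q i (q i + r)) := by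
    refine Prod.ext (by simp) (funext fun j => ?_)
    by_cases hj : j = i
    · subst hj; simp
    · simp [hj]
  rw [this]
  exact hnash i _

/-- With equal next states the unknown continuation terms cancel, and only the explicit gain is
left. -/
theorem Market.marginal_sub_of_nextReduced_eq (m : Market) (t : ℕ) (h : Fin 2 → Reduced → ℝ)
    (y : Fin 2 → ℕ → Reduced → ℝ) {v w : Reduced × (Fin 2 → ℝ)} (i : Fin 2)
    (hadd : m.nextReduced t (v + (0, Pi.single i 1)) = m.nextReduced t (w + (0, Pi.single i 1)))
    (hsub : m.nextReduced t (v - (0, Pi.single i 1)) = m.nextReduced t (w - (0, Pi.single i 1))) :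
    m.marginal t h y v i - m.marginal t h y w i =
      (m.gain t i (v + (0, Pi.single i 1)) - m.gain t i (v - (0, Pi.single i 1))) / 2
      - (m.gain t i (w + (0, Pi.single i 1)) - m.gain t i (w - (0, Pi.single i 1))) / 2 := by
  simp only [Market.marginal, Market.certaintyEquiv, hadd, hsub]
  ring

/-- The linear part of the first-order conditions is onto: move the volumes together with the
remaining volumes and the residual in such a way that the next reduced state is unchanged. -/
theorem Market.marginal_sub_surjective (m : Market) (t : ℕ) (hlam : 0 < m.lam t)
    (hdeg : m.alpha t + m.beta t ≠ 3 / 2) (h : Fin 2 → Reduced → ℝ)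
    (y : Fin 2 → ℕ → Reduced → ℝ) (w : Fin 2 → ℝ) :
    ∃ v, m.marginal t h y v - m.marginal t h y 0 = w := by
  have hd : 2 * (m.alpha t + m.beta t) - 3 ≠ 0 := fun h => hdeg (by linarith)
  have hl := hlam.ne'
  -- Along these moves the system is diagonal in the antisymmetric part `a` and the symmetric part
  -- `b` of the volumes, with eigenvalues -λ and λ(2(α + β) - 3); the resilience factor drops out.
  obtain ⟨a, ha⟩ : ∃ a, m.lam t * a = (w 1 - w 0) / 2 :=
    ⟨(w 1 - w 0) / 2 / m.lam t, by field_simp⟩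
  obtain ⟨b, hb⟩ : ∃ b, m.lam t * (2 * (m.alpha t + m.beta t) - 3) * b = (w 0 + w 1) / 2 :=
    ⟨(w 0 + w 1) / 2 / (m.lam t * (2 * (m.alpha t + m.beta t) - 3)), by field_simp⟩
  obtain ⟨q, hq0, hq1⟩ : ∃ q : Fin 2 → ℝ, q 0 = b + a ∧ q 1 = b - a :=
    ⟨![b + a, b - a], rfl, rfl⟩
  refine ⟨((q, -2 * m.alpha t * m.lam t * b, 0), q), funext fun i => ?_⟩
  rw [Pi.sub_apply, m.marginal_sub_of_nextReduced_eq]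
  · fin_cases i <;> simp [Market.gain, hq0, hq1] <;> linarith
  · refine Prod.ext (funext fun j => ?_) (Prod.ext ?_ ?_) <;> simp [Market.nextReduced, hq0, hq1]
    ring
  · refine Prod.ext (funext fun j => ?_) (Prod.ext ?_ ?_) <;> simp [Market.nextReduced, hq0, hq1]
    ring

/-- One date before the horizon, the first-order conditions determine the volumes. -/
theorem Market.marginal_injective_of_last (hm : m.Standing) (ht : t + 1 = m.horizon)
    (h1 : 1 ≤ t) (y : Fin 2 → ℕ → Reduced → ℝ) (q : Fin 2 → ℝ)
    (hq : m.marginal t (fun i u => -(m.lam m.horizon * (u.1 0 + u.1 1) * u.1 i)) y (0, q) =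
      m.marginal t (fun i u => -(m.lam m.horizon * (u.1 0 + u.1 1) * u.1 i)) y (0, 0)) :
    q = 0 := by
  have htI : t ∈ Finset.Icc 1 m.horizon := Finset.mem_Icc.2 ⟨h1, by omega⟩
  have hTI : m.horizon ∈ Finset.Icc 1 m.horizon := Finset.mem_Icc.2 ⟨by omega, le_rfl⟩
  have hIco : Finset.Ico t m.horizon = {t} := by rw [← ht]; simp
  have e0 := congrFun hq 0
  have e1 := congrFun hq 1
  simp [Market.marginal, Market.certaintyEquiv, hIco, Market.gain, Market.nextReduced] at e0 e1
  set κ := m.alpha t * Real.exp (-m.rho) + m.beta t with hκ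
  have hκ1 : κ < 1 := hm.impact_lt_one t htI
  have hc : 0 < m.lam t * (1 - κ) + m.lam m.horizon :=
    add_pos (mul_pos (hm.lam_pos t htI) (by linarith)) (hm.lam_pos _ hTI)
  have hg : ∀ i, 0 < m.gamma i * m.newsSigma t ^ 2 := fun i =>
    mul_pos (hm.gamma_pos i) (pow_pos (hm.newsSigma_pos t htI) 2)
  set c := m.lam t * (1 - κ) + m.lam m.horizon with hcdef
  have f0 : c * (2 * q 0 + q 1) + m.gamma 0 * m.newsSigma t ^ 2 * q 0 = 0 := by
    rw [hcdef]; linarith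
  have f1 : c * (q 0 + 2 * q 1) + m.gamma 1 * m.newsSigma t ^ 2 * q 1 = 0 := by
    rw [hcdef]; linarith
  -- Pairing the system with `q` gives a positive definite form, since `c > 0`.
  have hsum : c * (q 0 ^ 2 + q 1 ^ 2) + (c * (q 0 + q 1) ^ 2 +
      m.gamma 0 * m.newsSigma t ^ 2 * q 0 ^ 2 + m.gamma 1 * m.newsSigma t ^ 2 * q 1 ^ 2) = 0 := by
    linear_combination q 0 * f0 + q 1 * f1
  have hrest : 0 ≤ c * (q 0 + q 1) ^ 2 + m.gamma 0 * m.newsSigma t ^ 2 * q 0 ^ 2 +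
      m.gamma 1 * m.newsSigma t ^ 2 * q 1 ^ 2 := by
    have := hg 0
    have := hg 1
    positivity
  have hsq : q 0 ^ 2 + q 1 ^ 2 ≤ 0 := by
    by_contra hpos
    have := mul_pos hc (not_le.1 hpos)
    linarith
  have h0 : q 0 = 0 := by nlinarith [sq_nonneg (q 0), sq_nonneg (q 1)]
  have h1 : q 1 = 0 := by nlinarith [sq_nonneg (q 0), sq_nonneg (q 1)]
  funext i
  fin_cases i
  · exact h0
  · exact h1

end Algebra

end ExecutionGame

end

/-! ### Dynamics, deviations and backward induction. -/

noncomputable section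

namespace ExecutionGame

variable {Ω : Type*} {m : Market} {ξ : ℕ → Ω → ℝ × ℝ} {t : ℕ}

/-- The recursion appends the last date; backward induction has to split off the first. -/
theorem Market.stateFrom_succ (π : Fin 2 → MarkovStrategy) (t : ℕ) (s : State) (n : ℕ) (x : Ω) :
    m.stateFrom ξ π t s (n + 1) x =
      m.stateFrom ξ π (t + 1) (m.step t s (fun i => (π i).rule t s) (ξ t x)) n x := by
  induction n with
  | zero => rfl
  | succ n ih =>
    rw [Market.stateFrom, ih, Market.stateFrom]
    simp only [Nat.add_right_comm t 1 n, add_assoc]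

theorem Market.stateFrom_congr {π π' : Fin 2 → MarkovStrategy}
    (h : ∀ i, ∀ k, t ≤ k → (π' i).rule k = (π i).rule k) (s : State) (n : ℕ) (x : Ω) :
    m.stateFrom ξ π' t s n x = m.stateFrom ξ π t s n x := by
  induction n with
  | zero => rfl
  | succ n ih => simp only [Market.stateFrom, ih, h _ (t + n) (Nat.le_add_right t n)]

theorem Market.step_reduced (hσ : m.envSigma t = 0) (s : State) (q : Fin 2 → ℝ) (z : ℝ × ℝ) :
    (m.step t s q z).2.2 = m.nextReduced t (s.2.2, q) := by
  simp [Market.step, Market.nextReduced, hσ]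

/-- Marking to market removes the price level: trading at the current price leaves W - PQ unchanged,
so only impact and price increments count. -/
theorem Market.step_marked_wealth (hσ : m.envSigma t = 0) (s : State) (q : Fin 2 → ℝ) (z : ℝ × ℝ)
    (i : Fin 2) :
    (m.step t s q z).wealth i - (m.step t s q z).price * (m.step t s q z).remaining i =
      s.wealth i - s.price * s.remaining i + m.gain t i (s.2.2, q)
        - z.2 * (m.nextReduced t (s.2.2, q)).1 i := by
  simp only [Market.step, Market.nextReduced, Market.gain, hσ]
  ring

/-- The terminal wealth if only the decision at date `t` is changed. -/
theorem Market.HasTerminal.deviate {π : Fin 2 → MarkovStrategy} {i : Fin 2} {h : Reduced → ℝ}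
    {y : ℕ → Reduced → ℝ} (hT : m.HasTerminal ξ π (t + 1) i h y) (ht : t < m.horizon)
    (hσ : m.envSigma t = 0) {π' : Fin 2 → MarkovStrategy}
    (hπ' : ∀ j, ∀ k, t + 1 ≤ k → (π' j).rule k = (π j).rule k) (s : State) (x : Ω) :
    (m.stateFrom ξ π' t s (m.horizon + 1 - t) x).remaining i = 0 ∧
    (m.stateFrom ξ π' t s (m.horizon + 1 - t) x).wealth i =
      s.wealth i - s.price * s.remaining i
        + (m.gain t i (s.2.2, fun j => (π' j).rule t s)
          + h (m.nextReduced t (s.2.2, fun j => (π' j).rule t s)))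
        - ∑ k ∈ Finset.Ico t m.horizon, (ξ k x).2 * Function.update y t (fun u => u.1 i) k
            (m.nextReduced t (s.2.2, fun j => (π' j).rule t s)) := by
  have hn : m.horizon + 1 - t = (m.horizon + 1 - (t + 1)) + 1 := by omega
  rw [hn, Market.stateFrom_succ, Market.stateFrom_congr hπ']
  refine ⟨hT.remaining _ x, ?_⟩
  rw [hT.wealth, m.step_marked_wealth hσ, m.step_reduced hσ, Finset.sum_eq_sum_Ico_succ_bot ht,
    Function.update_self]
  have hsum : ∀ u : Reduced, ∑ k ∈ Finset.Ico (t + 1) m.horizon, (ξ k x).2 * y k u =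
      ∑ k ∈ Finset.Ico (t + 1) m.horizon,
        (ξ k x).2 * Function.update y t (fun u => u.1 i) k u := fun u =>
    Finset.sum_congr rfl fun k hk => by
      rw [Function.update_of_ne (by have := (Finset.mem_Ico.1 hk).1; omega)]
  rw [hsum]
  ring

variable [MeasurableSpace Ω] {μ : Measure Ω}

/-- The expected loss if only the decision at date `t` is changed. -/
theorem Market.HasTerminal.lintegral_deviate {π : Fin 2 → MarkovStrategy} {i : Fin 2}
    {h : Reduced → ℝ} {y : ℕ → Reduced → ℝ} (hT : m.HasTerminal ξ π (t + 1) i h y)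
    (hm : m.Standing) (hξ : m.IsNoise μ ξ) (h1 : 1 ≤ t) (ht : t < m.horizon)
    (hσ : m.envSigma t = 0) {π' : Fin 2 → MarkovStrategy}
    (hπ' : ∀ j, ∀ k, t + 1 ≤ k → (π' j).rule k = (π j).rule k) (s : State) :
    ∫⁻ x, m.terminalLoss i (m.stateFrom ξ π' t s (m.horizon + 1 - t) x) ∂μ =
      ENNReal.ofReal (Real.exp (-m.gamma i * (s.wealth i - s.price * s.remaining i +
        m.certaintyEquiv t i h y (s.2.2, fun j => (π' j).rule t s)))) := by
  have hS : Finset.Ico t m.horizon ⊆ Finset.Icc 1 m.horizon := fun k hk => by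
    simp only [Finset.mem_Ico, Finset.mem_Icc] at hk ⊢
    omega
  have hloss : ∀ x, m.terminalLoss i (m.stateFrom ξ π' t s (m.horizon + 1 - t) x) = _ := fun x => by
    rw [Market.terminalLoss, if_pos (hT.deviate ht hσ hπ' s x).1,
      (hT.deviate ht hσ hπ' s x).2]
  simp only [hloss]
  rw [hξ.lintegral_exp_sub_sum hm.corr_mem hS, Market.certaintyEquiv]
  congr 3
  ring

theorem Market.IsMarkovPerfect.lintegral_le {π : Fin 2 → MarkovStrategy}
    (hπ : m.IsMarkovPerfect μ ξ π) (ht : t ∈ Finset.Icc 1 m.horizon) (s : State) (i : Fin 2)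
    (dev : MarkovStrategy) :
    ∫⁻ x, m.terminalLoss i (m.stateFrom ξ π t s (m.horizon + 1 - t) x) ∂μ ≤
      ∫⁻ x, m.terminalLoss i
        (m.stateFrom ξ (Function.update π i dev) t s (m.horizon + 1 - t) x) ∂μ := by
  have := hπ t ht s i dev
  rw [Market.value, Market.value, EReal.neg_le_neg_iff] at this
  exact_mod_cast this

/-- The strategy `p` with the decision at date `t` replaced by the constant `r`. -/
def MarkovStrategy.override (p : MarkovStrategy) (t : ℕ) (r : ℝ) : MarkovStrategy where
  rule := Function.update p.rule t fun _ => r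
  measurable_rule k := by
    by_cases hk : k = t
    · subst hk
      rw [Function.update_self]
      exact measurable_const
    · rw [Function.update_of_ne hk]
      exact p.measurable_rule k

/-- At a Markov perfect equilibrium, the volumes at each date form a Nash equilibrium of the
one-shot game given by the certainty equivalents. -/
theorem Market.IsMarkovPerfect.certaintyEquiv_le {π : Fin 2 → MarkovStrategy}
    (hπ : m.IsMarkovPerfect μ ξ π) (hm : m.Standing) (hξ : m.IsNoise μ ξ) (h1 : 1 ≤ t)
    (ht : t < m.horizon) (hσ : m.envSigma t = 0) {i : Fin 2} {h : Reduced → ℝ}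
    {y : ℕ → Reduced → ℝ} (hT : m.HasTerminal ξ π (t + 1) i h y) (s : State) (r : ℝ) :
    m.certaintyEquiv t i h y (s.2.2, Function.update (fun j => (π j).rule t s) i r) ≤
      m.certaintyEquiv t i h y (s.2.2, fun j => (π j).rule t s) := by
  -- A constant deviation suffices because `s` is fixed.
  have hle := hπ.lintegral_le (Finset.mem_Icc.2 ⟨h1, ht.le⟩) s i ((π i).override t r)
  rw [hT.lintegral_deviate hm hξ h1 ht hσ fun _ _ _ => rfl,
    hT.lintegral_deviate hm hξ h1 ht hσ] at hle
  · have hrule : (fun j => (Function.update π i ((π i).override t r) j).rule t s) =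
        Function.update (fun j => (π j).rule t s) i r := by
      funext j
      by_cases hj : j = i
      · subst hj
        simp [MarkovStrategy.override]
      · simp [hj]
    rw [hrule, ENNReal.ofReal_le_ofReal_iff (Real.exp_pos _).le, Real.exp_le_exp] at hle
    nlinarith [hm.gamma_pos i]
  · intro j k hk
    by_cases hj : j = i
    · subst hj
      rw [Function.update_self]
      exact Function.update_of_ne (by omega) _ _
    · rw [Function.update_of_ne hj]

/-- At the last date, each trader executes the remaining volume. -/
theorem Market.IsMarkovPerfect.rule_horizon [IsProbabilityMeasure μ] {π : Fin 2 → MarkovStrategy}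
    (hπ : m.IsMarkovPerfect μ ξ π) (hm : m.Standing) (s : State) (i : Fin 2) :
    (π i).rule m.horizon s = s.remaining i := by
  have hle := hπ.lintegral_le (Finset.mem_Icc.2 ⟨hm.horizon_pos, le_rfl⟩) s i
    ((π i).override m.horizon (s.remaining i))
  have hn : m.horizon + 1 - m.horizon = 1 := by omega
  simp only [hn] at hle
  by_contra hne
  have hne' : s.remaining i - (π i).rule m.horizon s ≠ 0 := fun h => hne (by linarith)
  -- Leaving volume unexecuted costs an infinite loss in every scenario, while executing all of it
  -- costs a finite, nonrandom one.
  have htop : ∀ x, m.terminalLoss i (m.stateFrom ξ π m.horizon s 1 x) = ⊤ := fun x => by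
    rw [Market.terminalLoss, if_neg]
    exact hne'
  simp only [htop, lintegral_const, measure_univ, mul_one, top_le_iff] at hle
  refine absurd hle (ne_of_lt ?_)
  set π' := Function.update π i ((π i).override m.horizon (s.remaining i)) with hπ'
  have hrule : (π' i).rule m.horizon s = s.remaining i := by
    rw [hπ', Function.update_self]
    simp [MarkovStrategy.override]
  have hfin : ∀ x, m.terminalLoss i (m.stateFrom ξ π' m.horizon s 1 x) =
      ENNReal.ofReal (Real.exp (-m.gamma i * (s.wealth i - (s.price + m.lam m.horizon *
        ((π' 0).rule m.horizon s + (π' 1).rule m.horizon s)) * (π' i).rule m.horizon s))) :=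
    fun x => if_pos (sub_eq_zero.2 hrule.symm)
  simp only [hfin, lintegral_const, measure_univ, mul_one]
  exact ENNReal.ofReal_lt_top

/-- Both traders clear their positions, so the continuation is minus the impact cost, without
exposure to news. -/
theorem Market.IsMarkovPerfect.hasTerminal_horizon [IsProbabilityMeasure μ]
    {π : Fin 2 → MarkovStrategy} (hπ : m.IsMarkovPerfect μ ξ π) (hm : m.Standing) (i : Fin 2) :
    m.HasTerminal ξ π m.horizon i (fun u => -(m.lam m.horizon * (u.1 0 + u.1 1) * u.1 i))
      (fun _ _ => 0) where
  quad := by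
    simpa only [neg_one_mul, mul_assoc] using ((((isAff_remaining 0).add
      (isAff_remaining 1)).mul (isAff_remaining i)).const_mul (m.lam m.horizon)).const_mul (-1)
  aff k _ := IsAff.const 0
  remaining s x := by
    have hn : m.horizon + 1 - m.horizon = 1 := by omega
    rw [hn]
    simp [Market.stateFrom, Market.step, hπ.rule_horizon hm]
  wealth s x := by
    have hn : m.horizon + 1 - m.horizon = 1 := by omega
    rw [hn]
    simp only [Market.stateFrom, Market.step, hπ.rule_horizon hm, Finset.Ico_self,
      Finset.sum_empty, add_zero]
    ring

/-- Backward step: if the first-order conditions determine the volumes, then these are affine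
functions of the reduced state and the form of the terminal wealth is inherited. -/
theorem Market.IsMarkovPerfect.hasTerminal_step {π : Fin 2 → MarkovStrategy}
    (hπ : m.IsMarkovPerfect μ ξ π) (hm : m.Standing) (hξ : m.IsNoise μ ξ) (h1 : 1 ≤ t)
    (ht : t < m.horizon) (hσ : m.envSigma t = 0) {h : Fin 2 → Reduced → ℝ}
    {y : Fin 2 → ℕ → Reduced → ℝ} (hT : ∀ i, m.HasTerminal ξ π (t + 1) i (h i) (y i))
    (hinj : (∀ u, ∃ q, m.marginal t h y (u, q) = 0) →
      ∀ q, m.marginal t h y (0, q) = m.marginal t h y (0, 0) → q = 0) :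
    (∃ φ : Reduced → Fin 2 → ℝ, ∀ s i, (π i).rule t s = φ s.2.2 i) ∧
      ∃ (h' : Fin 2 → Reduced → ℝ) (y' : Fin 2 → ℕ → Reduced → ℝ),
        ∀ i, m.HasTerminal ξ π t i (h' i) (y' i) := by
  have hfoc : ∀ s : State, m.marginal t h y (s.2.2, fun j => (π j).rule t s) = 0 := fun s =>
    Market.marginal_eq_zero (fun i => (hT i).quad) (fun i => (hT i).aff) fun i r =>
      hπ.certaintyEquiv_le hm hξ h1 ht hσ (hT i) s r
  -- Equilibrium at every state gives solvability at every triple: complete `u` by zero wealth and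
  -- price.
  obtain ⟨φ, hφ, hφu⟩ := (Market.isAff_marginal (fun i => (hT i).quad)
    fun i => (hT i).aff).exists_isAff_solution (hinj fun u => ⟨_, hfoc (0, 0, u)⟩)
  have hrule : ∀ s : State, (fun j => (π j).rule t s) = φ s.2.2 := fun s => hφu _ _ (hfoc s)
  have hpair : IsAff fun u : Reduced => (u, φ u) := (IsAff.linear LinearMap.id).prodMk hφ
  have hnext := (m.isAff_nextReduced t).comp hpair
  refine ⟨⟨φ, fun s i => congrFun (hrule s) i⟩,
    fun i u => m.gain t i (u, φ u) + h i (m.nextReduced t (u, φ u)),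
    fun i k u => Function.update (y i) t (fun u => u.1 i) k (m.nextReduced t (u, φ u)),
    fun i => ⟨((m.isQuad_gain t i).comp hpair).add ((hT i).quad.comp hnext),
      fun k hk => (isAff_update (hT i).aff hk).comp hnext,
      fun s x => ((hT i).deviate ht hσ (fun _ _ _ => rfl) s x).1, fun s x => ?_⟩⟩
  rw [((hT i).deviate ht hσ (fun _ _ _ => rfl) s x).2, hrule s]

/-- Backward induction over the dates `2, …, T`. -/
theorem Market.IsMarkovPerfect.exists_hasTerminal [IsProbabilityMeasure μ]
    {π : Fin 2 → MarkovStrategy} (hπ : m.IsMarkovPerfect μ ξ π) (hm : m.Standing)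
    (hξ : m.IsNoise μ ξ)
    (hdeg : ∀ t : ℕ, 2 ≤ t → t + 2 ≤ m.horizon → m.alpha t + m.beta t ≠ 3 / 2)
    (hσ : ∀ t ∈ Finset.Icc 1 m.horizon, m.envSigma t = 0) (n : ℕ) (hn : t + n = m.horizon)
    (ht : 2 ≤ t) :
    (∃ φ : Reduced → Fin 2 → ℝ, ∀ s i, (π i).rule t s = φ s.2.2 i) ∧
      ∃ (h : Fin 2 → Reduced → ℝ) (y : Fin 2 → ℕ → Reduced → ℝ),
        ∀ i, m.HasTerminal ξ π t i (h i) (y i) := by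
  induction n generalizing t with
  | zero =>
    obtain rfl : t = m.horizon := hn
    exact ⟨⟨fun u => u.1, hπ.rule_horizon hm⟩, _, _, hπ.hasTerminal_horizon hm⟩
  | succ n ih =>
    have htI : t ∈ Finset.Icc 1 m.horizon := Finset.mem_Icc.2 ⟨by omega, by omega⟩
    -- Date T - 1 is separate: `hdeg` does not cover it, but the continuation is explicit there.
    rcases n with _ | n
    · refine hπ.hasTerminal_step hm hξ (by omega) (by omega) (hσ t htI)
        (h := fun i u => -(m.lam m.horizon * (u.1 0 + u.1 1) * u.1 i)) (y := fun _ _ _ => 0)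
        (fun i => ?_) fun _ q hq => ?_
      · have : t + 1 = m.horizon := by omega
        rw [this]
        exact hπ.hasTerminal_horizon hm i
      · exact Market.marginal_injective_of_last hm (by omega) (by omega) _ q hq
    · obtain ⟨-, h, y, hT⟩ := ih (t := t + 1) (by omega) (by omega)
      refine hπ.hasTerminal_step hm hξ (by omega) (by omega) (hσ t htI) hT fun hsolv q hq => ?_
      exact (Market.isAff_marginal (fun i => (hT i).quad) fun i => (hT i).aff).eq_zero_of_solvable
        hsolv (m.marginal_sub_surjective t (hm.lam_pos t htI) (hdeg t ht (by omega)) h y) q hq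

end ExecutionGame

end
-- The corollary.
open ExecutionGame in
theorem corollary3p1 {Ω : Type*} [MeasurableSpace Ω] (μ : Measure Ω) [IsProbabilityMeasure μ]
    (m : Market) (hm : m.Standing)
    (hdeg : ∀ t : ℕ, 2 ≤ t → t + 2 ≤ m.horizon → m.alpha t + m.beta t ≠ 3 / 2)
    (ξ : ℕ → Ω → ℝ × ℝ) (hξ : m.IsNoise μ ξ)
    (henv : IsDeterministic μ m.horizon (m.env ξ))
    (π : Fin 2 → MarkovStrategy) (hπ : m.IsMarkovPerfect μ ξ π)
    (w : Fin 2 → ℝ) (p : ℝ) (Q : Fin 2 → ℝ) (i : Fin 2) :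
    IsDeterministic μ m.horizon (m.volume ξ π (initialState w p Q) i) := by
  have hσ := fun t ht => hξ.envSigma_eq_zero henv (t := t) ht
  have hrule : ∀ t, 2 ≤ t → t ≤ m.horizon →
      ∃ φ : Reduced → Fin 2 → ℝ, ∀ s j, (π j).rule t s = φ s.2.2 j := fun t h2 hT =>
    (hπ.exists_hasTerminal hm hξ hdeg hσ (m.horizon - t) (by omega) h2).1
  -- Triple and volumes are constant in every scenario, not just almost surely; `n` counts the steps
  -- after date 1.
  have hvol : ∀ n, n < m.horizon → ∃ (u : Reduced) (q : Fin 2 → ℝ), ∀ x,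
      (m.stateFrom ξ π 1 (initialState w p Q) n x).2.2 = u ∧
      (fun j => (π j).rule (1 + n) (m.stateFrom ξ π 1 (initialState w p Q) n x)) = q := by
    intro n
    induction n with
    | zero =>
      exact fun _ => ⟨(initialState w p Q).2.2, fun j => (π j).rule 1 (initialState w p Q),
        fun x => ⟨rfl, rfl⟩⟩
    | succ n ih =>
      intro hn
      obtain ⟨u, q, huq⟩ := ih (by omega)
      obtain ⟨φ, hφ⟩ := hrule (1 + (n + 1)) (by omega) (by omega)
      have hu : ∀ x, (m.stateFrom ξ π 1 (initialState w p Q) (n + 1) x).2.2 =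
          m.nextReduced (1 + n) (u, q) := fun x => by
        rw [Market.stateFrom, m.step_reduced (hσ _ (Finset.mem_Icc.2 ⟨by omega, by omega⟩)),
          (huq x).1, (huq x).2]
      exact ⟨_, φ (m.nextReduced (1 + n) (u, q)), fun x =>
        ⟨hu x, funext fun j => by rw [hφ, hu x]⟩⟩
  choose! u q huq using hvol
  refine ⟨fun t => q (t - 1) i, fun t ht => Filter.Eventually.of_forall fun x => ?_⟩
  obtain ⟨h1, hT⟩ := Finset.mem_Icc.1 ht
  have := congrFun (huq (t - 1) (by omega) x).2 i
  rwa [Nat.add_sub_cancel' h1] at this
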